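/- For a group $H$ let $\mathcal K(H,2)$ be the kernel of the homomorphism $H\times H\to H^{\rm ab}=H/[H,H]$, $(h_1,h_2)\mapsto\overline{h_1h_2}$. For a group $G$ with a presentation $G\cong F/N$, $F$ free, put $$\widetilde{\mathcal K}(G,2):=\mathcal K(F,2)/\langle\!\langle\mathcal K(N,2)\rangle\!\rangle,$$ where $\langle\!\langle\mathcal K(N,2)\rangle\!\rangle$ is the normal closure of $\mathcal K(N,2)$ inside $F\times F$. If $G$ is Abelian, $(g,g^{-1})\mapsto g$ is an isomorphism $\mathcal K(G,2)\cong G$, and composing it with the map $\widetilde{\mathcal K}(G,2)\to\mathcal K(G,2)$ induced by $F\to G$ gives a homomorphism $q:\widetilde{\mathcal K}(G,2)\to G$. A cover of a finite group $G$ is a short exact sequence $1\to M\to G^\ast\to G\to 1$ such that $M$ is central in $G^\ast$, $M\le[G^\ast,G^\ast]$, and $M$ is isomorphic to the Schur multiplier $H^2(G,\mathbb C^\ast)$ (trivial action). Let $p$ be a prime, let $G$ be a finite Abelian $p$-group, and let $G\cong F/N$ be any presentation of $G$ with $F$ free. 1. If $p\neq 2$, then there is a short exact sequence $$0\to H_2(G,\mathbb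 Z)\to\widetilde{\mathcal K}(G,2)\xrightarrow{\,q\,}G\to 1,$$ and it makes $\widetilde{\mathcal K}(G,2)$ a cover of $G$. 2. If $G$ is an elementary Abelian $2$-group (that is, $g^2=1$ for all $g\in G$), then $\widetilde{\mathcal K}(G,2)$ is an elementary Abelian $2$-group. More precisely, there is a short exact sequence $0\to H_2(G,\mathbb Z)\xrightarrow{\,\iota\,}\widetilde{\mathcal K}(G,2)\xrightarrow{\,q\,}G\to 1$ and an isomorphism $\widetilde{\mathcal K}(G,2)\cong G\times H_2(G,\mathbb Z)$ that carries $\iota$ to the inclusion of the second factor and $q$ to the projection onto the first. -/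

import Mathlib

universe u

noncomputable section

namespace NatCentralExt

/-! ### The auxiliary group `𝒦(G, n)` -/

section Kernel

variable (G : Type*) [Group G] (n : ℕ)

/-- The homomorphism `ψ : Gⁿ → Gᵃᵇ` sending `(g₁, …, gₙ)` to the class of the ordered product
`g₁ ⋯ gₙ`. -/
def psi : (Fin n → G) →* Abelianization G where
  toFun g := Abelianization.of (List.ofFn g).prod
  map_one' := by simp [List.prod_ofFn, map_list_prod, List.map_ofFn]
  map_mul' g h := by
    simp only [map_list_prod, List.map_ofFn, List.prod_ofFn, Function.comp_apply, Pi.mul_apply,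
      map_mul, Finset.prod_mul_distrib]

/-- `𝒦(G, n)`, the kernel of `ψ : Gⁿ → Gᵃᵇ`. -/
def K : Subgroup (Fin n → G) := (psi G n).ker

variable {G n}

lemma psi_apply (g : Fin n → G) : psi G n g = ∏ i, Abelianization.of (g i) := by
  simp [psi, map_list_prod, List.map_ofFn, List.prod_ofFn]

lemma mem_K {g : Fin n → G} : g ∈ K G n ↔ ∏ i, Abelianization.of (g i) = 1 := by
  rw [K, MonoidHom.mem_ker, psi_apply]

variable {H : Type*} [Group H]

lemma map_mem_K (f : G →* H) {g : Fin n → G} (hg : g ∈ K G n) : f.compLeft (Fin n) g ∈ K H n := by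
  rw [mem_K] at hg ⊢
  simpa using congrArg (Abelianization.map f) hg

/-- The map `𝒦(G, n) → 𝒦(H, n)` induced by a homomorphism `f : G → H`. -/
def mapK (f : G →* H) (n : ℕ) : K G n →* K H n :=
  ((f.compLeft (Fin n)).comp (K G n).subtype).codRestrict (K H n) fun g => map_mem_K f g.2

end Kernel

/-- For abelian `G`, the isomorphism `𝒦(G, 2) ≅ G` whose inverse is `g ↦ (g, g⁻¹)`. -/
def kTwoEquiv (G : Type*) [CommGroup G] : K G 2 ≃* G where
  toFun x := x.1 0
  invFun g := ⟨![g, g⁻¹], by simp [mem_K, Fin.prod_univ_two]⟩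
  left_inv := by
    rintro ⟨x, hx⟩
    have h : Abelianization.of (x 0 * x 1) = 1 := by
      simpa [mem_K, Fin.prod_univ_two] using hx
    have h' : x 0 * x 1 = 1 := by
      simpa using congrArg (Abelianization.lift (MonoidHom.id G)) h
    ext i
    fin_cases i
    · simp
    · simp [eq_inv_of_mul_eq_one_right h']
  right_inv g := by simp
  map_mul' x y := rfl

/-! ### The group `𝒦̃(G, n)`

A presentation `G ≅ F / N` is given by a surjective homomorphism `π : F → G` from a free group,
with `N = ker π`. -/

section KTilde

variable {F G : Type*} [Group F] [Group G]

/-- The normal closure in `Fⁿ` of `𝒦(N, n)`, where `N = ker π` and `𝒦(N, n) ≤ Nⁿ` is regarded as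
a subgroup of `Fⁿ`. -/
def relators (π : F →* G) (n : ℕ) : Subgroup (Fin n → F) :=
  Subgroup.normalClosure
    ((K π.ker n).map (π.ker.subtype.compLeft (Fin n)) : Set (Fin n → F))

instance (π : F →* G) (n : ℕ) : (relators π n).Normal := Subgroup.normalClosure_normal

/-- `𝒦̃(G, n) = 𝒦(F, n) / ⟪𝒦(N, n)⟫`, computed with the presentation `π : F → G`. -/
abbrev KTilde (π : F →* G) (n : ℕ) : Type _ := K F n ⧸ (relators π n).subgroupOf (K F n)

/-- The relators lie in `𝒦(F, n)`, so the quotient above is a quotient by all of them. -/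
lemma relators_le_K (π : F →* G) (n : ℕ) : relators π n ≤ K F n := by
  have : (K F n).Normal := by unfold K; infer_instance
  refine Subgroup.normalClosure_le_normal ?_
  rintro _ ⟨x, hx, rfl⟩
  exact map_mem_K π.ker.subtype hx

lemma relators_le_ker (π : F →* G) (n : ℕ) : relators π n ≤ (π.compLeft (Fin n)).ker := by
  refine Subgroup.normalClosure_le_normal ?_
  rintro _ ⟨x, -, rfl⟩
  rw [SetLike.mem_coe, MonoidHom.mem_ker]
  funext i
  exact (x i).2

/-- The natural map `𝒦̃(G, n) → 𝒦(G, n)` induced by `π`. -/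
def KTilde.toK (π : F →* G) (n : ℕ) : KTilde π n →* K G n :=
  QuotientGroup.lift _ (mapK π n) fun _ hx =>
    Subtype.ext (relators_le_ker π n (Subgroup.mem_subgroupOf.mp hx))

end KTilde

/-- For abelian `G`, the map `𝒦̃(G, 2) → 𝒦(G, 2) ≅ G`. -/
def KTilde.toBase {F G : Type*} [Group F] [CommGroup G] (π : F →* G) : KTilde π 2 →* G :=
  (kTwoEquiv G).toMonoidHom.comp (KTilde.toK π 2)

/-! ### Homology, Schur multiplier, covers -/

/-- `H₂(G, ℤ)`, written multiplicatively. (Mathlib's group homology needs the coefficient ring in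
the universe of `G`, hence the `ULift`.) -/
abbrev H2 (G : Type u) [Group G] : Type u :=
  Multiplicative (groupHomology (Rep.trivial (ULift.{u} ℤ) G (ULift.{u} ℤ)) 2)

/-- The Schur multiplier `H²(G, ℂ^*)` with trivial action, written multiplicatively. -/
abbrev SchurMultiplier (G : Type u) [Group G] : Type u :=
  Multiplicative (groupCohomology (Rep.trivial (ULift.{u} ℤ) G (ULift.{u} (Additive ℂˣ))) 2)

/-- The short exact sequence `1 → M → E → G → 1` makes `E` a cover of the finite group `G`:
`M` is central in `E`, lies in `[E, E]`, and is isomorphic to the Schur multiplier of `G`. -/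
structure IsCover {M E : Type*} {G : Type u} [Group M] [Group E] [Group G]
    (S : GroupExtension M E G) : Prop where
  central : S.inl.range ≤ Subgroup.center E
  le_commutator : S.inl.range ≤ commutator E
  multiplier : Nonempty (M ≃* SchurMultiplier G)

/-- Elementary abelian `p`-groups (the trivial group included). -/
def IsElementaryAbelian (p : ℕ) (G : Type*) [Group G] : Prop :=
  (∀ x y : G, x * y = y * x) ∧ ∀ x : G, x ^ p = 1

end NatCentralExt

end

namespace NatCentralExt

open scoped commutatorElement IsMulCommutative

/-! ### Central extensions from 2-cocycles -/

/-! Put `N = ker π`. As `G` is abelian, `[F, F] ≤ N`, so modulo `[N, F]` the group `F` has class at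
most two and its commutator is bilinear. A pair `x` is a relator iff `x 0 ∈ N` and `x 0 * x 1 ∈ [N,
F]` (`mem_relators_iff`). Hence `c ↦ (1, c)` identifies `(N ∩ [F, F]) / [N, F]` with the kernel of
`q`, which is central; by Hopf's formula it is `H₂(G, ℤ)`.

The commutator of `(x, x⁻¹)` and `(y, y⁻¹)` is `([x, y], [x⁻¹, y⁻¹])`, which by bilinearity equals
`(1, [x, y]²)` modulo relators. So the squares of elements of the kernel are commutators; for odd
`|G|` the kernel has odd exponent and lies in the derived subgroup. If `G` has exponent 2, so has
`𝒦̃(G, 2)`, and the sequence splits as one of `𝔽₂`-spaces.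

Hopf's formula comes from comparing `F` with the central extension given by the universal 2-cocycle,
valued in 2-chains modulo boundaries. Since `ℂˣ` is divisible, the Schur multiplier is the character
group of `H₂`; as `H₂` is finite, the two are isomorphic. -/

/-- An (inhomogeneous) 2-cocycle with values in an abelian group with trivial action. -/
structure TwoCocycle (G A : Type*) [Group G] [AddCommGroup A] where
  toFun : G → G → A
  cocycle (g h j : G) : toFun h j + toFun g (h * j) = toFun g h + toFun (g * h) j

namespace TwoCocycle

variable {G A : Type*} [Group G] [AddCommGroup A]

lemma one_left (c : TwoCocycle G A) (g : G) : c.toFun 1 g = c.toFun 1 1 := by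
  simpa using c.cocycle 1 1 g

lemma one_right (c : TwoCocycle G A) (g : G) : c.toFun g 1 = c.toFun 1 1 := by
  simpa using (c.cocycle g 1 1).symm

/-- The central extension of `G` by `A` defined by a 2-cocycle. -/
@[ext]
structure Ext (c : TwoCocycle G A) where
  fst : A
  snd : G

variable {c : TwoCocycle G A}

instance : Mul c.Ext := ⟨fun x y => ⟨x.fst + y.fst + c.toFun x.snd y.snd, x.snd * y.snd⟩⟩
-- Cocycles are not assumed normalised, which is why `c(1, 1)` enters the identity, the inverse and
-- `incl`.
instance : One c.Ext := ⟨⟨-c.toFun 1 1, 1⟩⟩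
instance : Inv c.Ext :=
  ⟨fun x => ⟨-x.fst - c.toFun x.snd⁻¹ x.snd - c.toFun 1 1, x.snd⁻¹⟩⟩

@[simp] lemma Ext.mul_fst (x y : c.Ext) :
    (x * y).fst = x.fst + y.fst + c.toFun x.snd y.snd := rfl
@[simp] lemma Ext.mul_snd (x y : c.Ext) : (x * y).snd = x.snd * y.snd := rfl
@[simp] lemma Ext.one_fst : (1 : c.Ext).fst = -c.toFun 1 1 := rfl
@[simp] lemma Ext.one_snd : (1 : c.Ext).snd = 1 := rfl
@[simp] lemma Ext.inv_fst (x : c.Ext) :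
    x⁻¹.fst = -x.fst - c.toFun x.snd⁻¹ x.snd - c.toFun 1 1 := rfl
@[simp] lemma Ext.inv_snd (x : c.Ext) : x⁻¹.snd = x.snd⁻¹ := rfl

instance : Group c.Ext :=
  Group.ofLeftAxioms
    (fun x y z => by
      ext
      · have := c.cocycle x.snd y.snd z.snd
        simp only [Ext.mul_fst, Ext.mul_snd]
        rw [← sub_eq_zero] at this ⊢
        rw [← neg_eq_zero, ← this]
        abel
      · simp [mul_assoc])
    (fun x => by
      ext
      · simp [c.one_left]
      · simp)
    (fun x => by
      ext
      · simp only [Ext.mul_fst, Ext.inv_fst, Ext.inv_snd, Ext.one_fst]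
        abel
      · simp)

lemma Ext.comm_of_snd_eq_one {x : c.Ext} (hx : x.snd = 1) (y : c.Ext) : x * y = y * x := by
  ext
  · simp [hx, c.one_left, c.one_right, add_comm]
  · simp [hx]

variable (c)

/-- The projection of the extension onto `G`. -/
def proj : c.Ext →* G where
  toFun := Ext.snd
  map_one' := rfl
  map_mul' _ _ := rfl

/-- The inclusion of the kernel of a cocycle extension. -/
def incl : Multiplicative A →* c.Ext where
  toFun a := ⟨a.toAdd - c.toFun 1 1, 1⟩
  map_one' := by ext <;> simp
  map_mul' a b := by
    ext
    · simp only [toAdd_mul, Ext.mul_fst]; abel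
    · simp

lemma incl_mul_mk (g h : G) :
    c.incl (Multiplicative.ofAdd (c.toFun g h)) * ⟨0, g * h⟩ = (⟨0, g⟩ * ⟨0, h⟩ : c.Ext) := by
  ext
  · simp [incl, c.one_left]
  · simp [incl]

end TwoCocycle

/-! ### Homomorphisms that differ by central elements -/

/-- The pointwise quotient of `α` by `β` is a homomorphism into an abelian group, so it kills
commutators. -/
lemma eq_on_commutator_of_central {F Q : Type*} [Group F] [Group Q] (α β : F →* Q)
    (h : ∀ f, α f * (β f)⁻¹ ∈ Subgroup.center Q) {n : F} (hn : n ∈ commutator F) :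
    α n = β n := by
  let δ : F →* Subgroup.center Q :=
    { toFun f := ⟨α f * (β f)⁻¹, h f⟩
      map_one' := by ext; simp
      map_mul' x y := by
        ext
        have := Subgroup.mem_center_iff.mp (h y) (β x)⁻¹
        simp only [map_mul, mul_inv_rev, Subgroup.coe_mul]
        calc α x * α y * ((β y)⁻¹ * (β x)⁻¹) = α x * (α y * (β y)⁻¹ * (β x)⁻¹) := by group
          _ = _ := by rw [← this]; group }
  have : δ n = 1 := Abelianization.commutator_subset_ker δ hn
  exact mul_inv_eq_one.mp (congrArg Subtype.val this)

lemma commutatorElement_eq_of_central {E : Type*} [Group E] {z w : E}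
    (hz : z ∈ Subgroup.center E) (hw : w ∈ Subgroup.center E) (x y : E) :
    ⁅z * x, w * y⁆ = ⁅x, y⁆ := by
  rw [Subgroup.mem_center_iff] at hz hw
  simp only [commutatorElement_def, mul_inv_rev]
  calc z * x * (w * y) * (x⁻¹ * z⁻¹) * (y⁻¹ * w⁻¹)
      = z * (x * w) * y * x⁻¹ * z⁻¹ * y⁻¹ * w⁻¹ := by group
    _ = (z * w) * (x * y * x⁻¹) * z⁻¹ * y⁻¹ * w⁻¹ := by rw [hw x]; group
    _ = (w * z) * (x * y * x⁻¹) * z⁻¹ * y⁻¹ * w⁻¹ := by rw [hw z]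
    _ = w * (x * y * x⁻¹ * z) * z⁻¹ * y⁻¹ * w⁻¹ := by rw [mul_assoc w z, ← hz (x * y * x⁻¹)]
    _ = w * (x * y * x⁻¹ * y⁻¹) * w⁻¹ := by group
    _ = x * y * x⁻¹ * y⁻¹ := by rw [← hw]; group

/-! ### Hopf's formula -/

/-- `A`, together with the cocycle `c`, is the target of the universal 2-cocycle on `G`, and
`d : A → C` is the map induced by the bar differential onto the free abelian group `C` on `G`. -/
structure UniversalCocycle (G A C : Type u) [Group G] [AddCommGroup A] [AddCommGroup C] where
  c : TwoCocycle G A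
  e : G → C
  d : A →+ C
  d_apply (g h : G) : d (c.toFun g h) = e h - e (g * h) + e g
  lift_cocycle {X : Type u} [AddCommGroup X] (b : TwoCocycle G X) :
    ∃ σ : A →+ X, ∀ g h, σ (c.toFun g h) = b.toFun g h
  lift_fun {X : Type u} [AddCommGroup X] (f : G → X) : ∃ υ : C →+ X, ∀ g, υ (e g) = f g
  hom_ext {X : Type u} [AddCommGroup X] {σ τ : A →+ X}
    (h : ∀ g h, σ (c.toFun g h) = τ (c.toFun g h)) : σ = τ

section Hopf

variable {G A C F : Type u} [Group G] [AddCommGroup A] [AddCommGroup C] [Group F]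
  (U : UniversalCocycle G A C)

/-- The homomorphism from the universal extension to the free abelian group on `G`. -/
def UniversalCocycle.weight : U.c.Ext →* Multiplicative C where
  toFun x := Multiplicative.ofAdd (U.d x.fst + U.e x.snd)
  map_one' := by
    have := U.d_apply 1 1
    simp only [mul_one, sub_self, zero_add] at this
    simp [this]
  map_mul' x y := by
    rw [← ofAdd_add]
    congr 1
    simp only [TwoCocycle.Ext.mul_fst, TwoCocycle.Ext.mul_snd, map_add, U.d_apply]
    abel

lemma UniversalCocycle.d_one_one : U.d (U.c.toFun 1 1) = U.e 1 := by
  simpa using U.d_apply 1 1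

/-- In the abelianization, `c(g, h)` becomes the coboundary of `g ↦ (0, g)`, so the map from `A`
factors through `d`. This gives surjectivity in Hopf's formula. -/
lemma UniversalCocycle.incl_mem_commutator {a : A} (ha : U.d a = 0) :
    U.c.incl (Multiplicative.ofAdd a) ∈ commutator U.c.Ext := by
  obtain ⟨υ, hυ⟩ := U.lift_fun (X := Additive (Abelianization U.c.Ext))
    fun g => Additive.ofMul (Abelianization.of ⟨0, g⟩)
  have key : (MonoidHom.toAdditive (Abelianization.of.comp U.c.incl)).comp
      (AddEquiv.additiveMultiplicative A).symm.toAddMonoidHom = υ.comp U.d := by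
    refine U.hom_ext fun g h => ?_
    have := congrArg Abelianization.of (U.c.incl_mul_mk g h)
    rw [map_mul, map_mul] at this
    have h2 := congrArg Additive.ofMul (eq_mul_inv_of_mul_eq this)
    simp only [AddMonoidHom.comp_apply, U.d_apply, map_add, map_sub, hυ]
    refine h2.trans ?_
    simp only [ofMul_mul, ofMul_inv]
    abel
  have h1 := DFunLike.congr_fun key a
  simp only [AddMonoidHom.comp_apply, ha, map_zero] at h1
  rw [← Abelianization.ker_of, MonoidHom.mem_ker]
  exact h1

variable (π : F →* G) {φ : F →* U.c.Ext} (hφ : ∀ f, (φ f).snd = π f)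

include hφ in
-- The image of `φ` meets every coset of the centre, and commutators depend only on such cosets.
lemma UniversalCocycle.commutator_le_map (hπ : Function.Surjective π) :
    commutator U.c.Ext ≤ (commutator F).map φ := by
  have hc : ∀ z : U.c.Ext, z.snd = 1 → z ∈ Subgroup.center U.c.Ext := fun z hz =>
    Subgroup.mem_center_iff.mpr fun y => (TwoCocycle.Ext.comm_of_snd_eq_one hz y).symm
  have hs : ∀ x : U.c.Ext, ∃ f, x * (φ f)⁻¹ ∈ Subgroup.center U.c.Ext := fun x => by
    obtain ⟨f, hf⟩ := hπ x.snd
    exact ⟨f, hc _ (by simp [hφ, hf])⟩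
  rw [commutator_def, Subgroup.commutator_le]
  intro x _ y _
  obtain ⟨f, hf⟩ := hs x
  obtain ⟨g, hg⟩ := hs y
  have := commutatorElement_eq_of_central hf hg (φ f) (φ g)
  rw [inv_mul_cancel_right, inv_mul_cancel_right] at this
  rw [this, ← map_commutatorElement]
  exact Subgroup.mem_map_of_mem _
    (Subgroup.commutator_mem_commutator (Subgroup.mem_top _) (Subgroup.mem_top _))

lemma mk_mem_center_of_mem_ker {n : F} (hn : π n = 1) :
    (QuotientGroup.mk n : F ⧸ ⁅π.ker, (⊤ : Subgroup F)⁆) ∈ Subgroup.center _ := by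
  rw [Subgroup.mem_center_iff]
  intro y
  induction y using QuotientGroup.induction_on with
  | H y =>
    rw [← QuotientGroup.mk_mul, ← QuotientGroup.mk_mul, QuotientGroup.eq]
    -- Equality of the cosets of `y n` and `n y` means that `(y n)⁻¹ n y = [n⁻¹, y⁻¹]` lies in `[N,
    -- F]`.
    have := Subgroup.commutator_mem_commutator (H₁ := π.ker) (H₂ := (⊤ : Subgroup F))
      (MonoidHom.mem_ker.mpr (show π n⁻¹ = 1 by simp [hn])) (Subgroup.mem_top y⁻¹)
    simpa [commutatorElement_def, mul_assoc] using this

include hφ in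
-- By universality there is a map `ψ` from the universal extension back to `F / [N, F]`. Then `ψ ∘
-- φ` and the quotient map differ by central elements, so they agree on `[F, F]`. This gives
-- injectivity in Hopf's formula.
lemma UniversalCocycle.mem_of_map_eq_one (hπ : Function.Surjective π) {n : F}
    (hn : n ∈ commutator F) (h1 : φ n = 1) : n ∈ ⁅π.ker, (⊤ : Subgroup F)⁆ := by
  let Q := F ⧸ ⁅π.ker, (⊤ : Subgroup F)⁆
  let s : G → Q := fun g => QuotientGroup.mk (Function.surjInv hπ g)
  have hs : ∀ g, π (Function.surjInv hπ g) = g := Function.surjInv_eq hπ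
  -- The factor set of the section `s` of `F / [N, F] → G`.
  let b : TwoCocycle G (Additive (Subgroup.center Q)) :=
    { toFun g h := Additive.ofMul ⟨s g * s h * (s (g * h))⁻¹, by
        have := mk_mem_center_of_mem_ker π (n := Function.surjInv hπ g * Function.surjInv hπ h *
          (Function.surjInv hπ (g * h))⁻¹) (by simp [hs])
        simpa using this⟩
      cocycle g h j := by
        have hc : s h * s j * (s (h * j))⁻¹ ∈ Subgroup.center Q := by
          have := mk_mem_center_of_mem_ker π (n := Function.surjInv hπ h * Function.surjInv hπ j *
            (Function.surjInv hπ (h * j))⁻¹) (by simp [hs])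
          simpa using this
        rw [Subgroup.mem_center_iff] at hc
        apply Additive.toMul.injective
        ext
        simp only [toMul_add, toMul_ofMul, Subgroup.coe_mul]
        calc _ = (s h * s j * (s (h * j))⁻¹ * s g) * s (h * j) * (s (g * (h * j)))⁻¹ := by group
          _ = _ := by rw [← hc, ← mul_assoc g h j]; group }
  obtain ⟨σ, hσ⟩ := U.lift_cocycle b
  let τ : A → Q := fun a => ((σ a).toMul : Subgroup.center Q)
  have hτ : ∀ a, τ a ∈ Subgroup.center Q := fun a => ((σ a).toMul : Subgroup.center Q).2
  have hτadd : ∀ a a', τ (a + a') = τ a * τ a' := fun a a' => by simp [τ]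
  have hτc : ∀ g h, τ (U.c.toFun g h) = s g * s h * (s (g * h))⁻¹ := fun g h => by
    simp only [τ, hσ]; rfl
  let ψ : U.c.Ext →* Q := MonoidHom.mk' (fun x => τ x.fst * s x.snd) fun x y => by
    have := Subgroup.mem_center_iff.mp (hτ y.fst) (s x.snd)
    simp only [TwoCocycle.Ext.mul_fst, TwoCocycle.Ext.mul_snd, hτadd, hτc]
    calc _ = τ x.fst * (τ y.fst * s x.snd) * s y.snd := by group
      _ = _ := by rw [← this]; group
  have key := eq_on_commutator_of_central (QuotientGroup.mk' ⁅π.ker, (⊤ : Subgroup F)⁆)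
    (ψ.comp φ) (fun f => by
      have h2 := mk_mem_center_of_mem_ker π (n := f * (Function.surjInv hπ (π f))⁻¹)
        (by simp [hs])
      have h3 := mul_mem h2 (inv_mem (hτ (φ f).fst))
      have h4 : (ψ.comp φ) f = τ (φ f).fst * s (π f) := by simp [ψ, hφ]
      rw [h4, mul_inv_rev, ← mul_assoc]
      exact h3) hn
  rw [MonoidHom.comp_apply, h1, map_one] at key
  exact (QuotientGroup.eq_one_iff n).mp key

/-- Hopf's formula. -/
theorem UniversalCocycle.hopf [IsFreeGroup F] (hπ : Function.Surjective π) :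
    ∃ θ : (π.ker ⊓ commutator F : Subgroup F) →* Multiplicative U.d.ker,
      Function.Surjective θ ∧
        θ.ker = ⁅π.ker, (⊤ : Subgroup F)⁆.subgroupOf (π.ker ⊓ commutator F) := by
  -- Freeness of `F` supplies this lift of `π` to the universal extension.
  let φ : F →* U.c.Ext := IsFreeGroup.lift fun x => ⟨0, π (IsFreeGroup.of x)⟩
  have hφ' : U.c.proj.comp φ = π := IsFreeGroup.ext_hom fun x => by
    simp [φ, TwoCocycle.proj]
  have hφ : ∀ f, (φ f).snd = π f := fun f => DFunLike.congr_fun hφ' f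
  have hd : ∀ n : (π.ker ⊓ commutator F : Subgroup F),
      (φ n).fst + U.c.toFun 1 1 ∈ U.d.ker := fun n => by
    -- The target of `weight` is abelian, so commutators have weight one; over `1 ∈ G` this says
    -- that the shifted first coordinate is a cycle.
    have h1 : U.weight (φ n) = 1 :=
      Abelianization.commutator_subset_ker (U.weight.comp φ) n.2.2
    have h2 : U.d (φ n).fst + U.e (φ n).snd = 0 := h1
    rw [hφ, MonoidHom.mem_ker.mp n.2.1] at h2
    rw [AddMonoidHom.mem_ker, map_add, U.d_one_one, h2]
  let θ : (π.ker ⊓ commutator F : Subgroup F) →* Multiplicative U.d.ker :=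
    MonoidHom.mk' (fun n => Multiplicative.ofAdd ⟨_, hd n⟩) fun m n => by
      rw [← ofAdd_add]
      congr 1
      ext
      have hm := MonoidHom.mem_ker.mp m.2.1
      have hn := MonoidHom.mem_ker.mp n.2.1
      simp only [Subgroup.coe_mul, map_mul, TwoCocycle.Ext.mul_fst, hφ, hm, hn,
        AddSubgroup.coe_add]
      abel
  have hθ : ∀ n, θ n = 1 ↔ φ n = 1 := fun n => by
    have h1 : θ n = 1 ↔ (φ n).fst + U.c.toFun 1 1 = 0 := by
      exact (Subtype.ext_iff (a1 := (θ n).toAdd) (a2 := 0))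
    rw [h1, TwoCocycle.Ext.ext_iff]
    simp [hφ, MonoidHom.mem_ker.mp n.2.1, eq_neg_iff_add_eq_zero]
  refine ⟨θ, fun a => ?_, ?_⟩
  · obtain ⟨n, hn, hna⟩ := U.commutator_le_map π hφ hπ (U.incl_mem_commutator a.toAdd.2)
    refine ⟨⟨n, ?_, hn⟩, ?_⟩
    · change π n = 1
      rw [← hφ, hna]
      rfl
    · apply Multiplicative.toAdd.injective
      ext
      change (φ n).fst + U.c.toFun 1 1 = _
      rw [hna]
      simp [TwoCocycle.incl]
  · ext n
    rw [MonoidHom.mem_ker, hθ, Subgroup.mem_subgroupOf]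
    refine ⟨fun h => U.mem_of_map_eq_one π hφ hπ n.2.2 h, fun h => ?_⟩
    -- `φ` sends `N` into the fibre over `1`, which is central.
    have h3 : ⁅π.ker, (⊤ : Subgroup F)⁆ ≤ φ.ker := by
      rw [Subgroup.commutator_le]
      intro x hx y _
      rw [MonoidHom.mem_ker, map_commutatorElement, commutatorElement_eq_one_iff_mul_comm]
      exact TwoCocycle.Ext.comm_of_snd_eq_one (by rw [hφ]; exact hx) _
    exact h3 h

end Hopf

end NatCentralExt

noncomputable section

namespace NatCentralExt

/-! ### The universal cocycle of the bar complex -/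

section Bar

/-- The additive map out of the free `ULift ℤ`-module on `ι` extending `f`. -/
def liftULift {ι : Type*} {X : Type*} [AddCommGroup X] (f : ι → X) :
    (ι →₀ ULift.{u} ℤ) →+ X :=
  Finsupp.liftAddHom fun i => (zmultiplesHom X (f i)).comp AddEquiv.ulift.toAddMonoidHom

@[simp]
lemma liftULift_single {ι : Type*} {X : Type*} [AddCommGroup X] (f : ι → X) (i : ι)
    (a : ULift.{u} ℤ) : liftULift f (Finsupp.single i a) = a.down • f i := by
  simp [liftULift]
  rfl

lemma hom_ext_ulift {ι : Type*} {X : Type*} [AddCommGroup X] {σ τ : (ι →₀ ULift.{u} ℤ) →+ X}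
    (h : ∀ i, σ (Finsupp.single i 1) = τ (Finsupp.single i 1)) : σ = τ := by
  ext i a
  have ha : (Finsupp.single i a : ι →₀ ULift.{u} ℤ) = a.down • Finsupp.single i 1 := by
    rw [Finsupp.smul_single]
    congr 1
    ext
    simp
  simp only [AddMonoidHom.comp_apply, Finsupp.singleAddHom_apply]
  rw [ha, map_zsmul, map_zsmul, h]

variable (G : Type u) [Group G]

/-- The trivial representation on `ℤ`. -/
abbrev trivialInt : Rep (ULift.{u} ℤ) G := Rep.trivial (ULift.{u} ℤ) G (ULift.{u} ℤ)

/-- 2-chains modulo 2-boundaries. -/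
abbrev BarQuotient : Type u :=
  (G × G →₀ ULift.{u} ℤ) ⧸ (groupHomology.boundaries₂ (trivialInt G)).toAddSubgroup

/-- The differential on 2-chains modulo 2-boundaries. -/
def barDifferential : BarQuotient G →+ (G →₀ ULift.{u} ℤ) :=
  QuotientAddGroup.lift _ (groupHomology.d₂₁ (trivialInt G)).hom.toAddMonoidHom fun x hx =>
    groupHomology.mem_cycles₂_of_mem_boundaries₂ (A := trivialInt G) x hx

/-- The hypothesis is the vanishing of `f` on the boundary of each basic 3-chain. -/
lemma boundaries_le_ker {X : Type*} [AddCommGroup X] (f : (G × G →₀ ULift.{u} ℤ) →+ X)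
    (hf : ∀ g h j : G, f (Finsupp.single (h, j) 1) + f (Finsupp.single (g, h * j) 1) =
      f (Finsupp.single (g, h) 1) + f (Finsupp.single (g * h, j) 1)) :
    (groupHomology.boundaries₂ (trivialInt G)).toAddSubgroup ≤ f.ker := by
  rintro _ ⟨x, rfl⟩
  have : f.comp (groupHomology.d₃₂ (trivialInt G)).hom.toAddMonoidHom = 0 := by
    refine hom_ext_ulift fun ⟨g, h, j⟩ => ?_
    change f (groupHomology.d₃₂ (trivialInt G) _) = 0
    rw [groupHomology.d₃₂_single]
    simp only [map_add, map_sub, Representation.trivial_apply]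
    rw [sub_add_eq_add_sub, hf]
    abel
  exact DFunLike.congr_fun this x

/-- The universal 2-cocycle on `G`. -/
def barCocycle : UniversalCocycle G (BarQuotient G) (G →₀ ULift.{u} ℤ) where
  c :=
    { toFun g h := QuotientAddGroup.mk (Finsupp.single (g, h) 1)
      cocycle g h j := by
        have h1 : groupHomology.d₃₂ (trivialInt G) (Finsupp.single (g, h, j) 1) ∈
            (groupHomology.boundaries₂ (trivialInt G)).toAddSubgroup := ⟨_, rfl⟩
        rw [← QuotientAddGroup.eq_zero_iff, groupHomology.d₃₂_single] at h1
        simp only [Representation.trivial_apply, QuotientAddGroup.mk_add,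
          QuotientAddGroup.mk_sub] at h1
        rw [← sub_eq_zero, ← h1]
        abel }
  e g := Finsupp.single g 1
  d := barDifferential G
  d_apply g h := by
    change groupHomology.d₂₁ (trivialInt G) (Finsupp.single (g, h) 1) = _
    rw [groupHomology.d₂₁_single]
    simp
  lift_cocycle b := by
    refine ⟨QuotientAddGroup.lift _ (liftULift fun x => b.toFun x.1 x.2) ?_, fun g h => ?_⟩
    · exact boundaries_le_ker G _ fun g h j => by simpa using b.cocycle g h j
    · simp
  lift_fun f := ⟨liftULift f, fun g => by simp⟩
  hom_ext h := by
    refine QuotientAddGroup.addMonoidHom_ext _ (hom_ext_ulift fun x => h x.1 x.2)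

/-- Cycles modulo boundaries are the kernel of the differential on the bar quotient. -/
def cyclesToKer : groupHomology.cycles₂ (trivialInt G) →+ (barCocycle G).d.ker where
  toFun x := ⟨QuotientAddGroup.mk x.1, x.2⟩
  map_zero' := rfl
  map_add' _ _ := rfl

lemma cyclesToKer_surjective : Function.Surjective (cyclesToKer G) := by
  rintro ⟨a, ha⟩
  induction a using QuotientAddGroup.induction_on with
  | H a => exact ⟨⟨a, ha⟩, rfl⟩

lemma cyclesToKer_eq_zero_iff (x : groupHomology.cycles₂ (trivialInt G)) :
    cyclesToKer G x = 0 ↔ x.1 ∈ groupHomology.boundaries₂ (trivialInt G) := by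
  rw [Subtype.ext_iff]
  exact QuotientAddGroup.eq_zero_iff _

/-- Two surjections with the same kernel have isomorphic targets. -/
def addEquivOfKerEq {A B C : Type*} [AddGroup A] [AddGroup B] [AddGroup C] (f : A →+ B)
    (g : A →+ C) (hf : Function.Surjective f) (hg : Function.Surjective g) (h : f.ker = g.ker) :
    B ≃+ C :=
  (QuotientAddGroup.quotientKerEquivOfSurjective f hf).symm.trans
    ((QuotientAddGroup.quotientAddEquivOfEq h).trans
      (QuotientAddGroup.quotientKerEquivOfSurjective g hg))

/-- The second homology group in terms of the universal cocycle. -/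
def kerEquivHomology : (barCocycle G).d.ker ≃+ groupHomology (trivialInt G) 2 :=
  addEquivOfKerEq (cyclesToKer G) (groupHomology.H2π (trivialInt G)).hom.toAddMonoidHom
    (cyclesToKer_surjective G)
    ((ModuleCat.epi_iff_surjective (groupHomology.H2π (trivialInt G))).mp inferInstance) <| by
      ext x
      rw [AddMonoidHom.mem_ker, cyclesToKer_eq_zero_iff, ← groupHomology.H2π_eq_zero_iff]
      rfl

lemma fg_ker_barDifferential [Finite G] : AddGroup.FG (barCocycle G).d.ker := by
  have : IsNoetherianRing (ULift.{u} ℤ) :=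
    isNoetherianRing_of_ringEquiv ℤ (ULift.ringEquiv (R := ℤ)).symm
  have h1 : Module.Finite (ULift.{u} ℤ) (groupHomology.cycles₂ (trivialInt G)) := inferInstance
  have h2 : Module.Finite ℤ (ULift.{u} ℤ) := Module.Finite.equiv ULift.moduleEquiv.symm
  have h3 := Module.Finite.iff_addGroup_fg.mp
    (Module.Finite.trans (R := ℤ) (ULift.{u} ℤ) (groupHomology.cycles₂ (trivialInt G)))
  exact AddGroup.fg_of_surjective (cyclesToKer_surjective G)

end Bar

/-! ### The Schur multiplier as a dual -/

section Schur

/-- The multiplicative group of `ℂ`, written additively. -/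
abbrev AddUnitsComplex : Type u := ULift.{u} (Additive ℂˣ)

lemma nsmul_surjective_addUnitsComplex {n : ℕ} (hn : n ≠ 0) :
    Function.Surjective fun x : AddUnitsComplex.{u} => n • x := by
  rintro ⟨y⟩
  obtain ⟨z, hz⟩ := IsAlgClosed.exists_pow_nat_eq (y.toMul : ℂ) (Nat.pos_of_ne_zero hn)
  have hz0 : z ≠ 0 := by
    rintro rfl
    rw [zero_pow hn] at hz
    exact y.toMul.ne_zero hz.symm
  refine ⟨⟨Additive.ofMul (Units.mk0 z hz0)⟩, ?_⟩
  apply ULift.down_injective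
  apply Additive.toMul.injective
  ext
  exact hz

/-- `ℂˣ` is divisible because `ℂ` is algebraically closed, hence injective by Baer's criterion. -/
lemma exists_extension_addUnitsComplex {M N : Type*} [AddCommGroup M] [AddCommGroup N]
    (f : M →+ N) (hf : Function.Injective f) (g : M →+ AddUnitsComplex.{u}) :
    ∃ h : N →+ AddUnitsComplex.{u}, h.comp f = g := by
  let _ : DivisibleBy AddUnitsComplex.{u} ℕ :=
    divisibleByOfSMulRightSurj _ _ fun hn => nsmul_surjective_addUnitsComplex hn
  let _ : DivisibleBy AddUnitsComplex.{u} ℤ := AddGroup.divisibleByIntOfDivisibleByNat _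
  exact (Module.Baer.of_divisible _).extension_property_addMonoidHom f hf g

variable (G : Type u) [Group G]

/-- The trivial representation on the units of `ℂ`. -/
abbrev trivialUnits : Rep (ULift.{u} ℤ) G := Rep.trivial (ULift.{u} ℤ) G AddUnitsComplex.{u}

variable {G}

/-- A 2-cocycle of the standard complex as a `TwoCocycle`. -/
def toTwoCocycle (f : groupCohomology.cocycles₂ (trivialUnits G)) :
    TwoCocycle G AddUnitsComplex.{u} where
  toFun g h := f.1 (g, h)
  cocycle g h j := by
    have := (groupCohomology.mem_cocycles₂_iff f.1).mp f.2 g h j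
    rw [add_comm (f.1 (g, h)), this]
    rfl

lemma exists_hom_of_cocycle (f : groupCohomology.cocycles₂ (trivialUnits G)) :
    ∃ σ : BarQuotient G →+ AddUnitsComplex.{u},
      ∀ g h, σ ((barCocycle G).c.toFun g h) = f.1 (g, h) :=
  (barCocycle G).lift_cocycle (toTwoCocycle f)

variable (G) in
/-- The pairing of cocycles with chains modulo boundaries. -/
def cocycleHom : groupCohomology.cocycles₂ (trivialUnits G) →+
    (BarQuotient G →+ AddUnitsComplex.{u}) :=
  -- The chosen homomorphism is determined by its values on the universal cocycle, so the choice is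
  -- additive.
  AddMonoidHom.mk' (fun f => (exists_hom_of_cocycle f).choose) fun f f' =>
    (barCocycle G).hom_ext fun g h => by
      rw [AddMonoidHom.add_apply, (exists_hom_of_cocycle f).choose_spec,
        (exists_hom_of_cocycle f').choose_spec, (exists_hom_of_cocycle (f + f')).choose_spec]
      rfl

lemma cocycleHom_apply (f : groupCohomology.cocycles₂ (trivialUnits G)) (g h : G) :
    cocycleHom G f ((barCocycle G).c.toFun g h) = f.1 (g, h) :=
  (exists_hom_of_cocycle f).choose_spec g h

variable (G) in
/-- The pairing of cocycles with second homology. -/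
def cocycleDual : groupCohomology.cocycles₂ (trivialUnits G) →+
    ((barCocycle G).d.ker →+ AddUnitsComplex.{u}) :=
  AddMonoidHom.mk' (fun f => (cocycleHom G f).comp (barCocycle G).d.ker.subtype) fun f f' => by
    rw [map_add, AddMonoidHom.add_comp]

/-- Injectivity of `ℂˣ` extends a character of the cycles to all chains modulo boundaries; its
values on the universal cocycle form a 2-cocycle. -/
lemma cocycleDual_surjective : Function.Surjective (cocycleDual G) := fun χ => by
  obtain ⟨σ, hσ⟩ := exists_extension_addUnitsComplex (barCocycle G).d.ker.subtype
    (AddSubgroup.subtype_injective _) χ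
  refine ⟨⟨fun x => σ ((barCocycle G).c.toFun x.1 x.2), ?_⟩, ?_⟩
  · rw [groupCohomology.mem_cocycles₂_iff]
    intro g h j
    have := congrArg σ ((barCocycle G).c.cocycle g h j)
    rw [map_add, map_add] at this
    rw [add_comm, ← this]
    rfl
  · rw [← hσ]
    change (cocycleHom G _).comp _ = _
    congr 1
    exact (barCocycle G).hom_ext fun g h => cocycleHom_apply _ g h

/-- A cocycle that vanishes on cycles factors through the image of `d`. Extending it to all
1-chains, again by injectivity of `ℂˣ`, yields a cochain whose coboundary it is. -/
lemma cocycleDual_eq_zero_iff (f : groupCohomology.cocycles₂ (trivialUnits G)) :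
    cocycleDual G f = 0 ↔ f.1 ∈ groupCohomology.coboundaries₂ (trivialUnits G) := by
  constructor
  · intro h
    have hk : (barCocycle G).d.ker ≤ (cocycleHom G f).ker := fun a ha =>
      (DFunLike.congr_fun h ⟨a, ha⟩ : cocycleHom G f a = 0)
    obtain ⟨υ, hυ⟩ := exists_extension_addUnitsComplex
      (QuotientAddGroup.kerLift (barCocycle G).d) (QuotientAddGroup.kerLift_injective _)
      (QuotientAddGroup.lift _ (cocycleHom G f) hk)
    have hυ' : ∀ a, υ ((barCocycle G).d a) = cocycleHom G f a := fun a =>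
      DFunLike.congr_fun hυ (QuotientAddGroup.mk a)
    refine ⟨fun g => υ ((barCocycle G).e g), ?_⟩
    funext x
    have := hυ' ((barCocycle G).c.toFun x.1 x.2)
    rw [(barCocycle G).d_apply, cocycleHom_apply, map_add, map_sub] at this
    exact this
  · rintro ⟨x, hx⟩
    obtain ⟨υ, hυ⟩ := (barCocycle G).lift_fun (X := AddUnitsComplex.{u}) x
    have : cocycleHom G f = υ.comp (barCocycle G).d := (barCocycle G).hom_ext fun g h => by
      rw [cocycleHom_apply, ← hx, AddMonoidHom.comp_apply, (barCocycle G).d_apply, map_add,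
        map_sub, hυ, hυ, hυ]
      rfl
    refine AddMonoidHom.ext fun a => ?_
    change cocycleHom G f a.1 = 0
    rw [this, AddMonoidHom.comp_apply, AddMonoidHom.mem_ker.mp a.2, map_zero]

variable (G) in
/-- The Schur multiplier is dual to second homology. -/
def kerDualEquivCohomology :
    ((barCocycle G).d.ker →+ AddUnitsComplex.{u}) ≃+ groupCohomology (trivialUnits G) 2 :=
  addEquivOfKerEq (cocycleDual G) (groupCohomology.H2π (trivialUnits G)).hom.toAddMonoidHom
    cocycleDual_surjective
    ((ModuleCat.epi_iff_surjective (groupCohomology.H2π (trivialUnits G))).mp inferInstance) <| by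
      ext x
      rw [AddMonoidHom.mem_ker, cocycleDual_eq_zero_iff]
      exact (groupCohomology.H2π_eq_zero_iff x).symm

/-- Characters with values in `ℂˣ`, multiplicatively and additively. -/
def characterEquiv (M : Type*) [AddCommGroup M] :
    Additive (Multiplicative M →* ℂˣ) ≃+ (M →+ AddUnitsComplex.{u}) where
  toFun χ := AddEquiv.ulift.symm.toAddMonoidHom.comp (MonoidHom.toAdditiveRight χ.toMul)
  invFun χ := Additive.ofMul
    (AddMonoidHom.toMultiplicativeLeft (AddEquiv.ulift.toAddMonoidHom.comp χ))
  left_inv _ := rfl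
  right_inv _ := rfl
  map_add' _ _ := rfl

lemma finite_ker_barDifferential [Finite G] {m : ℕ} (hm : m ≠ 0)
    (h : ∀ a : (barCocycle G).d.ker, m • a = 0) : Finite (barCocycle G).d.ker := by
  have := fg_ker_barDifferential G
  exact AddCommGroup.finite_of_fg_isAddTorsion _ fun a =>
    isOfFinAddOrder_iff_nsmul_eq_zero.mpr ⟨m, Nat.pos_of_ne_zero hm, h a⟩

/-- A finitely generated group of finite exponent is finite here, and a finite abelian group is
non-canonically isomorphic to its group of complex characters. -/
theorem nonempty_H2_mulEquiv_schurMultiplier [Finite G] {m : ℕ} (hm : m ≠ 0)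
    (h : ∀ a : (barCocycle G).d.ker, m • a = 0) : Nonempty (H2 G ≃* SchurMultiplier G) := by
  have := finite_ker_barDifferential hm h
  obtain ⟨e⟩ := CommGroup.monoidHom_mulEquiv_of_hasEnoughRootsOfUnity
    (Multiplicative (barCocycle G).d.ker) ℂ
  exact ⟨(AddEquiv.toMultiplicative (kerEquivHomology G)).symm.trans <| e.symm.trans <|
    AddEquiv.toMultiplicativeRight ((characterEquiv.{u} _).trans (kerDualEquivCohomology G))⟩

end Schur

end NatCentralExt

end

noncomputable section

namespace NatCentralExt

open scoped commutatorElement IsMulCommutative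

/-! ### The structure of `𝒦̃(G, 2)` -/

section Structure

variable {F G : Type u} [Group F] [CommGroup G] (π : F →* G)

/-- The commutator subgroup `[N, F]`, where `N = ker π`. -/
abbrev kerCommutator : Subgroup F := ⁅π.ker, (⊤ : Subgroup F)⁆

lemma commutator_le_ker : commutator F ≤ π.ker := Abelianization.commutator_subset_ker π

lemma mk_mem_center {n : F} (hn : n ∈ π.ker) :
    (n : F ⧸ kerCommutator π) ∈ Subgroup.center (F ⧸ kerCommutator π) :=
  mk_mem_center_of_mem_ker π (MonoidHom.mem_ker.mp hn)

lemma mk_comm {n : F} (hn : n ∈ π.ker) (y : F) :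
    (y : F ⧸ kerCommutator π) * n = n * y :=
  Subgroup.mem_center_iff.mp (mk_mem_center π hn) y

lemma commutatorElement_mem_ker (x y : F) : ⁅x, y⁆ ∈ π.ker :=
  commutator_le_ker π
    (Subgroup.commutator_mem_commutator (Subgroup.mem_top x) (Subgroup.mem_top y))

/-- The commutator pairing of `F`, with values in the center of `F / [N, F]`. -/
def commutatorHom (y : F) : F →* Subgroup.center (F ⧸ kerCommutator π) :=
  MonoidHom.mk' (fun x => ⟨(⁅x, y⁆ : F), mk_mem_center π (commutatorElement_mem_ker π x y)⟩)
    fun x x' => by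
      ext
      have h := mk_comm π (commutatorElement_mem_ker π x' y) x
      have h' := mk_comm π (commutatorElement_mem_ker π x' y) ⁅x, y⁆
      have e : ⁅x * x', y⁆ = x * ⁅x', y⁆ * x⁻¹ * ⁅x, y⁆ := by
        simp only [commutatorElement_def]; group
      simp only [Subgroup.coe_mul]
      rw [e, QuotientGroup.mk_mul, QuotientGroup.mk_mul, QuotientGroup.mk_mul, h,
        QuotientGroup.mk_inv, mul_inv_cancel_right, h']

lemma mk_commutator_pow {k : ℕ} (x y : F) :
    (↑⁅x, y⁆ : F ⧸ kerCommutator π) ^ k = ↑⁅x ^ k, y⁆ :=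
  (congrArg Subtype.val (map_pow (commutatorHom π y) x k)).symm

/-- The pairing is bilinear, so the two signs cancel. -/
lemma mk_commutator_inv_inv (x y : F) :
    (↑⁅x⁻¹, y⁻¹⁆ : F ⧸ kerCommutator π) = ↑⁅x, y⁆ := by
  have h : ∀ x y : F, (↑⁅x⁻¹, y⁆ : F ⧸ kerCommutator π) = (↑⁅x, y⁆)⁻¹ := fun x y =>
    congrArg Subtype.val (map_inv (commutatorHom π y) x)
  have h' : ∀ x y : F, (↑⁅x, y⁆ : F ⧸ kerCommutator π)⁻¹ = ↑⁅y, x⁆ := fun x y => by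
    rw [← QuotientGroup.mk_inv, commutatorElement_inv]
  rw [h, h', h, h']

/-- Modulo `[N, F]` one has `[x, y] ^ k = [x ^ k, y]`, with `x ^ k ∈ N`, and commutators commute
with each other. -/
lemma pow_mem_kerCommutator {k : ℕ} (hk : ∀ g : G, g ^ k = 1) {c : F} (hc : c ∈ commutator F) :
    c ^ k ∈ kerCommutator π := by
  rw [commutator_eq_closure] at hc
  induction hc using Subgroup.closure_induction with
  | mem c hc =>
    obtain ⟨x, y, rfl⟩ := hc
    rw [← QuotientGroup.eq_one_iff, QuotientGroup.mk_pow]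
    refine (mk_commutator_pow π x y).trans ((QuotientGroup.eq_one_iff _).mpr ?_)
    exact Subgroup.commutator_mem_commutator
      (MonoidHom.mem_ker.mpr (by rw [map_pow, hk])) (Subgroup.mem_top y)
  | one => simp
  | mul c d hc hd ihc ihd =>
    rw [← commutator_eq_closure] at hc hd
    have : Commute (c : F ⧸ kerCommutator π) d := mk_comm π (commutator_le_ker π hd) c
    rw [← QuotientGroup.eq_one_iff, QuotientGroup.mk_pow] at ihc ihd ⊢
    rw [QuotientGroup.mk_mul, this.mul_pow, ihc, ihd, one_mul]
  | inv c _ ih => rw [inv_pow]; exact inv_mem ih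

/-! ### Explicit description of the relators. -/

lemma mem_K_two {x : Fin 2 → F} : x ∈ K F 2 ↔ x 0 * x 1 ∈ commutator F := by
  rw [mem_K, Fin.prod_univ_two, ← map_mul, ← MonoidHom.mem_ker, Abelianization.ker_of]

/-- The inclusion of the second factor. -/
def inSnd (F : Type*) [Group F] : F →* (Fin 2 → F) :=
  MonoidHom.mk' (fun f => ![1, f]) fun x y => by ext i; fin_cases i <;> simp

/-- The conditions cut out a normal subgroup because `N` is central modulo `[N, F]`; it contains
`𝒦(N, 2)` because `[N, N] ≤ [N, F]`. -/
lemma mem_ker_of_mem_relators (x : Fin 2 → F) (hx : x ∈ relators π 2) :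
    x 0 ∈ π.ker ∧ x 1 ∈ π.ker ∧ x 0 * x 1 ∈ kerCommutator π := by
  let L : Subgroup (Fin 2 → F) :=
    { carrier := {x | x 0 ∈ π.ker ∧ x 1 ∈ π.ker ∧ x 0 * x 1 ∈ kerCommutator π}
      one_mem' := by simp
      mul_mem' := by
        rintro x y ⟨h0, h1, h2⟩ ⟨k0, k1, k2⟩
        refine ⟨mul_mem h0 k0, mul_mem h1 k1, ?_⟩
        rw [← QuotientGroup.eq_one_iff, QuotientGroup.mk_mul] at h2 k2 ⊢
        have := mk_comm π k0 (x 1)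
        calc ((x 0 * y 0 : F) : F ⧸ kerCommutator π) * (x 1 * y 1 : F)
            = x 0 * (y 0 * x 1) * y 1 := by simp [mul_assoc]
          _ = (x 0 * x 1) * (y 0 * y 1) := by rw [← this]; simp [mul_assoc]
          _ = 1 := by rw [h2, k2, one_mul]
      inv_mem' := by
        rintro x ⟨h0, h1, h2⟩
        refine ⟨inv_mem h0, inv_mem h1, ?_⟩
        rw [← QuotientGroup.eq_one_iff, QuotientGroup.mk_mul] at h2 ⊢
        have := mk_comm π h0 (x 1)
        simp only [Pi.inv_apply, QuotientGroup.mk_inv]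
        rw [← mul_inv_rev, this, h2, inv_one] }
  have hL : L.Normal := ⟨by
    rintro x ⟨h0, h1, h2⟩ f
    have n : π.ker.Normal := inferInstance
    refine ⟨n.conj_mem _ h0 _, n.conj_mem _ h1 _, ?_⟩
    rw [← QuotientGroup.eq_one_iff, QuotientGroup.mk_mul] at h2 ⊢
    have k0 := mk_comm π h0 (f 0)
    have k1 := mk_comm π h1 (f 1)
    simp only [Pi.mul_apply, Pi.inv_apply, QuotientGroup.mk_mul, QuotientGroup.mk_inv]
    rw [k0, k1, mul_inv_cancel_right, mul_inv_cancel_right, h2]⟩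
  refine (Subgroup.normalClosure_le_normal (N := L) ?_ : relators π 2 ≤ L) hx
  rintro _ ⟨y, hy, rfl⟩
  refine ⟨(y 0).2, (y 1).2, ?_⟩
  have h1 : ((y 0 * y 1 : π.ker) : F) ∈ (commutator π.ker).map π.ker.subtype :=
    Subgroup.mem_map_of_mem _ (mem_K_two.mp hy)
  rw [commutator_def, Subgroup.map_commutator] at h1
  refine Subgroup.commutator_mono ?_ le_top h1
  rw [← MonoidHom.range_eq_map, Subgroup.range_subtype]

lemma pair_inv_mem_relators {n : F} (hn : n ∈ π.ker) : ![n, n⁻¹] ∈ relators π 2 := by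
  refine Subgroup.subset_normalClosure
    ⟨![⟨n, hn⟩, ⟨n, hn⟩⁻¹], by simp [mem_K, Fin.prod_univ_two], ?_⟩
  ext i
  fin_cases i <;> simp

/-- Dividing `(n⁻¹, n)` by its conjugate under `(1, f)` leaves `(1, [n, f])`. -/
lemma inSnd_mem_relators {b : F} (hb : b ∈ kerCommutator π) : inSnd F b ∈ relators π 2 := by
  have : kerCommutator π ≤ (relators π 2).comap (inSnd F) := by
    rw [Subgroup.commutator_le]
    intro n hn f _
    have h1 := pair_inv_mem_relators π (inv_mem hn)
    have h2 := (inferInstance : (relators π 2).Normal).conj_mem _ h1 (inSnd F f)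
    have h3 := mul_mem h1 (inv_mem h2)
    have e : ![n⁻¹, n⁻¹⁻¹] * (inSnd F f * ![n⁻¹, n⁻¹⁻¹] * (inSnd F f)⁻¹)⁻¹ = inSnd F ⁅n, f⁆ := by
      ext i
      fin_cases i <;> simp [inSnd, commutatorElement_def, mul_assoc]
    rw [e] at h3
    exact h3
  exact this hb

lemma eq_pair_mul_inSnd (x : Fin 2 → F) : x = ![x 0, (x 0)⁻¹] * inSnd F (x 0 * x 1) := by
  ext i
  fin_cases i <;> simp [inSnd]

lemma mem_relators_iff {x : Fin 2 → F} :
    x ∈ relators π 2 ↔ x 0 ∈ π.ker ∧ x 0 * x 1 ∈ kerCommutator π := by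
  refine ⟨fun h => ⟨(mem_ker_of_mem_relators π x h).1, (mem_ker_of_mem_relators π x h).2.2⟩,
    fun h => ?_⟩
  rw [eq_pair_mul_inSnd x]
  exact mul_mem (pair_inv_mem_relators π h.1) (inSnd_mem_relators π h.2)

/-! ### The kernel of `q`: centrality, exponent and commutators. -/

lemma KTilde.mk_eq_one_iff (x : K F 2) :
    (QuotientGroup.mk x : KTilde π 2) = 1 ↔
      x.1 0 ∈ π.ker ∧ x.1 0 * x.1 1 ∈ kerCommutator π := by
  rw [QuotientGroup.eq_one_iff, Subgroup.mem_subgroupOf, mem_relators_iff]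

lemma KTilde.toBase_surjective (hπ : Function.Surjective π) :
    Function.Surjective (KTilde.toBase π) := fun g => by
  obtain ⟨f, rfl⟩ := hπ g
  exact ⟨QuotientGroup.mk ⟨![f, f⁻¹], by simp [mem_K_two]⟩, rfl⟩

/-- The map `N ∩ [F, F] → 𝒦̃(G, 2)` sending `f` to the class of `(1, f)`. -/
def KTilde.ofCommutator : (π.ker ⊓ commutator F : Subgroup F) →* KTilde π 2 :=
  (QuotientGroup.mk' _).comp
    (((inSnd F).comp (Subgroup.subtype _)).codRestrict (K F 2) fun c =>
      mem_K_two.mpr (by simpa [inSnd] using c.2.2))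

lemma KTilde.ker_ofCommutator :
    (KTilde.ofCommutator π).ker = (kerCommutator π).subgroupOf (π.ker ⊓ commutator F) := by
  ext c
  rw [MonoidHom.mem_ker, Subgroup.mem_subgroupOf]
  refine (KTilde.mk_eq_one_iff π _).trans ?_
  simp [inSnd]

lemma KTilde.mk_eq_ofCommutator (x : K F 2) (hx : x.1 0 ∈ π.ker) :
    (QuotientGroup.mk x : KTilde π 2) = KTilde.ofCommutator π
      ⟨x.1 0 * x.1 1, commutator_le_ker π (mem_K_two.mp x.2), mem_K_two.mp x.2⟩ := by
  refine QuotientGroup.eq.mpr ?_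
  rw [Subgroup.mem_subgroupOf]
  have h := pair_inv_mem_relators π (inv_mem hx)
  -- This conjugate of `(x₀⁻¹, x₀)` is exactly `x⁻¹ * (1, x₀ x₁)`.
  have h2 := (inferInstance : (relators π 2).Normal).conj_mem _ h (inSnd F (x.1 0 * x.1 1)⁻¹)
  convert h2 using 1
  ext i
  fin_cases i <;> simp [inSnd]

lemma KTilde.range_ofCommutator : (KTilde.ofCommutator π).range = (KTilde.toBase π).ker := by
  apply le_antisymm
  · rintro _ ⟨c, rfl⟩
    exact map_one π
  · intro z hz
    induction z using QuotientGroup.induction_on with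
    | H x => exact ⟨_, (KTilde.mk_eq_ofCommutator π x hz).symm⟩

lemma KTilde.ker_toBase_le_center : (KTilde.toBase π).ker ≤ Subgroup.center (KTilde π 2) := by
  rw [← KTilde.range_ofCommutator]
  rintro _ ⟨c, rfl⟩
  rw [Subgroup.mem_center_iff]
  intro z
  induction z using QuotientGroup.induction_on with
  | H x =>
    rw [← mul_inv_eq_one]
    refine (KTilde.mk_eq_one_iff π (x * ⟨inSnd F c, _⟩ * (⟨inSnd F c, _⟩ * x)⁻¹)).mpr ⟨?_, ?_⟩
    · simp [inSnd]
    · have h := mk_comm π c.2.1 (x.1 1)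
      rw [← QuotientGroup.eq_one_iff]
      simp [inSnd, h]

variable {π}

lemma KTilde.ofCommutator_pow {k : ℕ} (hk : ∀ g : G, g ^ k = 1)
    (c : (π.ker ⊓ commutator F : Subgroup F)) : KTilde.ofCommutator π c ^ k = 1 := by
  rw [← map_pow, ← MonoidHom.mem_ker, KTilde.ker_ofCommutator]
  exact pow_mem_kerCommutator π hk c.2.2

/-- For a basic commutator, the square is the class of `([x, y], [x⁻¹, y⁻¹])`, itself a commutator
in `𝒦(F, 2)`. Centrality of the kernel of `q` extends this to products. -/
lemma KTilde.sq_ofCommutator_mem (c : (π.ker ⊓ commutator F : Subgroup F)) :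
    KTilde.ofCommutator π c ^ 2 ∈ commutator (KTilde π 2) := by
  obtain ⟨c, hN, hc⟩ := c
  have hc' := hc
  rw [commutator_eq_closure] at hc'
  induction hc' using Subgroup.closure_induction with
  | mem c hc' =>
    obtain ⟨x, y, rfl⟩ := hc'
    let X : K F 2 := ⟨![x, x⁻¹], by simp [mem_K_two]⟩
    let Y : K F 2 := ⟨![y, y⁻¹], by simp [mem_K_two]⟩
    have h : ⁅(QuotientGroup.mk X : KTilde π 2), QuotientGroup.mk Y⁆ ∈
      commutator (KTilde π 2) :=
      Subgroup.commutator_mem_commutator (Subgroup.mem_top _) (Subgroup.mem_top _)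
    have e : ⁅(QuotientGroup.mk X : KTilde π 2), QuotientGroup.mk Y⁆ = QuotientGroup.mk ⁅X, Y⁆ :=
      (map_commutatorElement (QuotientGroup.mk' _) X Y).symm
    rw [e, KTilde.mk_eq_ofCommutator π ⁅X, Y⁆ (commutatorElement_mem_ker π x y)] at h
    convert h using 1
    rw [← map_pow, MonoidHom.eq_iff, KTilde.ker_ofCommutator, Subgroup.mem_subgroupOf,
      ← QuotientGroup.eq_one_iff]
    have e0 : (⁅X, Y⁆ : K F 2).1 0 = ⁅x, y⁆ := rfl
    have e1 : (⁅X, Y⁆ : K F 2).1 1 = ⁅x⁻¹, y⁻¹⁆ := rfl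
    simp only [Subgroup.coe_mul, Subgroup.coe_inv, Subgroup.coe_pow, e0, e1,
      QuotientGroup.mk_mul, QuotientGroup.mk_inv, QuotientGroup.mk_pow, mk_commutator_inv_inv]
    group
  | one =>
    have : (⟨1, hN, hc⟩ : (π.ker ⊓ commutator F : Subgroup F)) = 1 := rfl
    simp [this]
  | mul a b ha hb iha ihb =>
    rw [← commutator_eq_closure] at ha hb
    have e : KTilde.ofCommutator π ⟨a * b, hN, hc⟩ =
        KTilde.ofCommutator π ⟨a, commutator_le_ker π ha, ha⟩ *
          KTilde.ofCommutator π ⟨b, commutator_le_ker π hb, hb⟩ :=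
      map_mul (KTilde.ofCommutator π) ⟨a, commutator_le_ker π ha, ha⟩
        ⟨b, commutator_le_ker π hb, hb⟩
    have hcomm : Commute (KTilde.ofCommutator π ⟨a, commutator_le_ker π ha, ha⟩)
        (KTilde.ofCommutator π ⟨b, commutator_le_ker π hb, hb⟩) :=
      Subgroup.mem_center_iff.mp (KTilde.ker_toBase_le_center π
        (KTilde.range_ofCommutator π ▸ ⟨_, rfl⟩)) _
    rw [e, hcomm.mul_pow]
    exact mul_mem (iha (commutator_le_ker π ha) ha) (ihb (commutator_le_ker π hb) hb)
  | inv a ha iha =>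
    rw [← commutator_eq_closure] at ha
    have e : KTilde.ofCommutator π ⟨a⁻¹, hN, hc⟩ =
        (KTilde.ofCommutator π ⟨a, commutator_le_ker π ha, ha⟩)⁻¹ :=
      map_inv (KTilde.ofCommutator π) ⟨a, commutator_le_ker π ha, ha⟩
    rw [e, inv_pow]
    exact inv_mem (iha (commutator_le_ker π ha) ha)

lemma KTilde.ker_toBase_le_commutator {k : ℕ} (hodd : Odd k) (hk : ∀ g : G, g ^ k = 1) :
    (KTilde.toBase π).ker ≤ commutator (KTilde π 2) := by
  rw [← KTilde.range_ofCommutator]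
  rintro _ ⟨c, rfl⟩
  obtain ⟨l, rfl⟩ := hodd
  -- `l + 1` inverts 2 modulo the exponent `2 * l + 1`.
  have h := pow_mem (KTilde.sq_ofCommutator_mem c) (l + 1)
  rwa [← pow_mul, mul_add, mul_one, show 2 * l + 2 = (2 * l + 1) + 1 by ring, pow_succ,
    KTilde.ofCommutator_pow hk, one_mul] at h

/-- Modulo `[N, F]`, `x₀` commutes with `x₀ x₁ ∈ N`, hence with `x₁`; so `x₀² x₁² = (x₀ x₁)²`, the
square of an element of `[F, F]`, which is trivial. -/
lemma KTilde.sq_eq_one (hk : ∀ g : G, g ^ 2 = 1) (z : KTilde π 2) : z ^ 2 = 1 := by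
  induction z using QuotientGroup.induction_on with
  | H x =>
    refine (KTilde.mk_eq_one_iff π (x ^ 2)).mpr ⟨?_, ?_⟩
    · rw [MonoidHom.mem_ker]
      exact (map_pow π _ 2).trans (hk _)
    · have hc := mem_K_two.mp x.2
      have h2 := pow_mem_kerCommutator π hk hc
      have h := mk_comm π (commutator_le_ker π hc) (x.1 0)
      rw [← QuotientGroup.eq_one_iff] at h2 ⊢
      simp only [Subgroup.coe_pow, Pi.pow_apply, QuotientGroup.mk_mul, QuotientGroup.mk_pow]
        at h2 h ⊢
      generalize (x.1 0 : F ⧸ kerCommutator π) = a at *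
      generalize (x.1 1 : F ⧸ kerCommutator π) = b at *
      have h' : a * b = b * a := by
        have := mul_left_cancel (h.trans (mul_assoc a b a))
        exact this
      rw [← h2, (show Commute a b from h').mul_pow]

end Structure

/-! ### Extensions of elementary abelian 2-groups -/

lemma IsElementaryAbelian.of_sq_eq_one {E : Type*} [Group E] (h : ∀ x : E, x ^ 2 = 1) :
    IsElementaryAbelian 2 E := by
  refine ⟨fun x y => ?_, h⟩
  have hi : ∀ x : E, x⁻¹ = x := fun x => by
    rw [inv_eq_iff_mul_eq_one, ← sq, h]
  calc x * y = (x * y)⁻¹ := (hi _).symm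
    _ = y * x := by rw [mul_inv_rev, hi, hi]

/-- Over `𝔽₂` the inclusion of `M` has a linear retraction; paired with the projection to `G` it is
the isomorphism. -/
lemma GroupExtension.exists_mulEquiv_prod {M E G : Type*} [CommGroup M] [CommGroup E] [Group G]
    (S : GroupExtension M E G) (h : ∀ x : E, x ^ 2 = 1) :
    ∃ e : E ≃* G × M, (∀ m, e (S.inl m) = (1, m)) ∧ ∀ x, (e x).1 = S.rightHom x := by
  have hM : ∀ m : M, m ^ 2 = 1 := fun m => S.inl_injective (by rw [map_pow, h, map_one])
  let _ : Module (ZMod 2) (Additive E) := AddCommGroup.zmodModule (n := 2) h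
  let _ : Module (ZMod 2) (Additive M) := AddCommGroup.zmodModule (n := 2) hM
  obtain ⟨r, hr⟩ := LinearMap.exists_leftInverse_of_injective
    (AddMonoidHom.toZModLinearMap 2 (MonoidHom.toAdditive S.inl))
    (LinearMap.ker_eq_bot.mpr S.inl_injective)
  let ρ : E →* M := AddMonoidHom.toMultiplicative r.toAddMonoidHom
  have hρ : ∀ m, ρ (S.inl m) = m := fun m => LinearMap.congr_fun hr m
  have hS : ∀ m, S.rightHom (S.inl m) = 1 := S.rightHom_inl
  refine ⟨MulEquiv.ofBijective (S.rightHom.prod ρ) ⟨?_, ?_⟩, fun m => ?_, fun x => rfl⟩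
  · rw [injective_iff_map_eq_one]
    intro x hx
    rw [MonoidHom.prod_apply, Prod.mk_eq_one] at hx
    obtain ⟨m, rfl⟩ : x ∈ S.inl.range := S.range_inl_eq_ker_rightHom ▸ hx.1
    rw [hρ] at hx
    rw [hx.2, map_one]
  · rintro ⟨g, m⟩
    obtain ⟨x, rfl⟩ := S.rightHom_surjective g
    exact ⟨x * S.inl ((ρ x)⁻¹ * m), by simp [hρ, hS]⟩
  · change (S.rightHom (S.inl m), ρ (S.inl m)) = _
    rw [hρ, hS]

/-! ### The extension -/

section Main

variable {G F : Type u} [CommGroup G] [Group F] [IsFreeGroup F] {π : F →* G}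

/-- By Hopf's formula every class comes from some `c ∈ [F, F]`, and `c ^ k ∈ [N, F]`. -/
lemma smul_ker_barDifferential_eq_zero (hπ : Function.Surjective π) {k : ℕ}
    (hk : ∀ g : G, g ^ k = 1) (a : (barCocycle G).d.ker) : k • a = 0 := by
  obtain ⟨θ, hθ, hker⟩ := (barCocycle G).hopf π hπ
  obtain ⟨c, hc⟩ := hθ (Multiplicative.ofAdd a)
  have : c ^ k ∈ θ.ker := by
    rw [hker]
    exact pow_mem_kerCommutator π hk c.2.2
  rw [MonoidHom.mem_ker, map_pow, hc] at this
  exact this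

/-- The extension of `G` by `H₂(G, ℤ)`. -/
lemma exists_extension (hπ : Function.Surjective π) :
    ∃ S : GroupExtension (H2 G) (KTilde π 2) G, S.rightHom = KTilde.toBase π := by
  obtain ⟨θ, hθ, hker⟩ := (barCocycle G).hopf π hπ
  -- The Hopf map and `KTilde.ofCommutator` have the same kernel `[N, F]`, so their images are
  -- isomorphic.
  let e : H2 G ≃* (KTilde.ofCommutator π).range :=
    (AddEquiv.toMultiplicative (kerEquivHomology G)).symm.trans <|
      (QuotientGroup.quotientKerEquivOfSurjective θ hθ).symm.trans <|
        (QuotientGroup.quotientMulEquivOfEq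
          (hker.trans (KTilde.ker_ofCommutator π).symm)).trans <|
            QuotientGroup.quotientKerEquivRange (KTilde.ofCommutator π)
  exact ⟨{
    inl := (Subgroup.subtype _).comp e.toMonoidHom
    rightHom := KTilde.toBase π
    inl_injective := (Subgroup.subtype_injective _).comp e.injective
    range_inl_eq_ker_rightHom := by
      have he : e.toMonoidHom.range = ⊤ := MonoidHom.range_eq_top.mpr e.surjective
      rw [MonoidHom.range_comp, he, ← MonoidHom.range_eq_map]
      exact (Subgroup.range_subtype _).trans (KTilde.range_ofCommutator π)
    rightHom_surjective := KTilde.toBase_surjective π hπ }, rfl⟩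

end Main

end NatCentralExt

end

open NatCentralExt in
theorem proposition4p2 {G F : Type u} [CommGroup G] [Finite G] [Group F] [IsFreeGroup F]
    (π : F →* G) (hπ : Function.Surjective π) (p : ℕ) [Fact p.Prime] (hG : IsPGroup p G) :
    (p ≠ 2 →
      ∃ S : GroupExtension (H2 G) (KTilde π 2) G,
        S.rightHom = KTilde.toBase π ∧ IsCover S) ∧
    (IsElementaryAbelian 2 G →
      IsElementaryAbelian 2 (KTilde π 2) ∧
      ∃ S : GroupExtension (H2 G) (KTilde π 2) G,
        S.rightHom = KTilde.toBase π ∧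
        ∃ e : KTilde π 2 ≃* G × H2 G,
          (∀ h : H2 G, e (S.inl h) = (1, h)) ∧ ∀ x : KTilde π 2, (e x).1 = S.rightHom x) := by
  obtain ⟨S, hS⟩ := exists_extension hπ
  refine ⟨fun hp => ⟨S, hS, ?_⟩, fun hE => ?_⟩
  · obtain ⟨n, hn⟩ := IsPGroup.iff_card.mp hG
    -- The order of `G` serves as the odd exponent.
    have hodd : Odd (Nat.card G) := hn ▸ ((Fact.out : p.Prime).odd_of_ne_two hp).pow
    have hk : ∀ g : G, g ^ Nat.card G = 1 := fun g => pow_card_eq_one'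
    have hr : S.inl.range = (KTilde.toBase π).ker := hS ▸ S.range_inl_eq_ker_rightHom
    exact
      { central := hr.trans_le (KTilde.ker_toBase_le_center π)
        le_commutator := hr.trans_le (KTilde.ker_toBase_le_commutator hodd hk)
        multiplier := nonempty_H2_mulEquiv_schurMultiplier Nat.card_pos.ne'
          (smul_ker_barDifferential_eq_zero hπ hk) }
  · have hsq : ∀ z : KTilde π 2, z ^ 2 = 1 := KTilde.sq_eq_one hE.2
    have hel := IsElementaryAbelian.of_sq_eq_one hsq
    let _ : CommGroup (KTilde π 2) := { mul_comm := hel.1 }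
    exact ⟨hel, S, hS, GroupExtension.exists_mulEquiv_prod S hsq⟩
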